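/- **Open online dial-a-ride on the line.** A server of capacity $c\in\{1,2,\dots\}\cup\{\infty\}$ starts at time $0$ in the origin of $\mathbb{R}$ and moves with speed at most $1$. Requests $r_i=(a_i,b_i;t_i)$, $i=1,\dots,n$ ($n\ge 1$), with $0<t_1<\dots<t_n$ are revealed at their release times $t_i$; each has to be loaded at $a_i$ not before time $t_i$ and carried to $b_i$, without being unloaded elsewhere, while at most $c$ requests are on board at any time. The server need not return to the origin. The completion time is the time at which all requests have been served; $\mathrm{Opt}(\sigma)$ is the optimal offline completion time for the request sequence $\sigma$, and $\mathrm{Opt}(t)$ the one for the requests released not later than $t$. The (strict) competitive ratio of an online algorithm $\mathrm{Alg}$ is $\sup_\sigma \mathrm{Alg}(\sigma)/\mathrm{Opt}(\sigma)$. **The algorithm $\mathrm{Lazy}(\alpha)$, $\alpha\ge 0$.** Whenever a request is released, at time $t$: if the server can deliver all loaded requests and be back in the origin by time $\alpha\cdot\mathrm{Opt}(t)$, it aborts its current command and does so in an optimal way; otherwise it continues its current command. Whenever the server is idle (it has completed its current command, or it has none and a request is released that does not make it return), at time $t$: if $t<\alpha\cdot\mathrm{Opt}(t)$, it waits at its position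 until time $\alpha\cdot\mathrm{Opt}(t)$; otherwise, if the set $R_t$ of released, unserved requests is non-empty, it follows a shortest schedule that starts at its current position and serves all requests in $R_t$. Ties between optimal choices are broken by an arbitrary deterministic online rule. **Corollary 1.** For every $\alpha\ge 0$, every capacity $c\in\{1,2,\dots\}\cup\{\infty\}$ and every tie-breaking rule, $\mathrm{Lazy}(\alpha)$ has competitive ratio at least $$\frac32+\sqrt{\frac{11}{12}}\approx 2.457$$ for open online dial-a-ride on the line. More precisely, its competitive ratio is at least $\max\{1+\alpha,\,2+\frac{2}{3\alpha}\}$ if $\alpha\ge 1$, and at least $1+\frac{3}{\alpha+1}$ if $0\le\alpha<1$. -/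

import Mathlib

open scoped ENNReal

namespace DialARide

/-- A transportation request on the real line: it appears at time `release`, has to be loaded at
`src` not earlier than that, and has to be unloaded at `dst`. -/
structure Request where
  src : ℝ
  dst : ℝ
  release : ℝ

/-- Request sequences `r₁, …, rₙ` (`n ≥ 1`) with release times `0 < t₁ < … < tₙ`. -/
def IsRequestSequence (σ : List Request) : Prop :=
  σ ≠ [] ∧ (∀ r ∈ σ, 0 < r.release) ∧ σ.Pairwise (fun r r' => r.release < r'.release)

/-- A plan of the server, in absolute time: its position at every time, the times at which it
loads and unloads requests, and the time at which the plan is completed. -/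
structure Schedule where
  pos : ℝ → ℝ
  load : Request → ℝ
  unload : Request → ℝ
  finish : ℝ

/-- From time `t₀` on, when it is in `x`, the server moves with speed at most one. -/
def Schedule.MovesFrom (s : Schedule) (x t₀ : ℝ) : Prop :=
  s.pos t₀ = x ∧ ∀ t t' : ℝ, t₀ ≤ t → t₀ ≤ t' → |s.pos t - s.pos t'| ≤ |t - t'|

open Classical in
/-- The server, with capacity `c`, never carries too many of the requests in `R`.
Several loadings and unloadings may happen at one time in a suitable order: requests that are due
are unloaded first. The first clause says that after all actions of time `t` at most `c` requests
are on board. The second one says that there is a free place for each `r` at the time when it is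
loaded, even if `r` is unloaded at that very time (as may happen when its source and destination
coincide). -/
def Schedule.RespectsCapacity (s : Schedule) (c : ℕ∞) (R : Finset Request) : Prop :=
  (∀ t : ℝ, ((R.filter (fun r => s.load r ≤ t ∧ t < s.unload r)).card : ℕ∞) ≤ c) ∧
  (∀ r ∈ R,
    ((R.filter (fun r' => s.load r' < s.load r ∧ s.load r < s.unload r')).card : ℕ∞) < c)

/-- `s` is a (non-preemptive) schedule for an empty server of capacity `c` that starts at time `t₀`
in `x` and has served all requests in `R` by time `s.finish`. -/
def Schedule.Serves (s : Schedule) (c : ℕ∞) (R : Finset Request) (x t₀ : ℝ) : Prop :=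
  s.MovesFrom x t₀ ∧ t₀ ≤ s.finish ∧
  (∀ r ∈ R, t₀ ≤ s.load r ∧ r.release ≤ s.load r ∧ s.pos (s.load r) = r.src ∧
    s.load r ≤ s.unload r ∧ s.pos (s.unload r) = r.dst ∧ s.unload r ≤ s.finish) ∧
  s.RespectsCapacity c R

/-- `s` is a shortest schedule `S(R, x)`, started at time `t₀`. -/
def Schedule.IsShortest (s : Schedule) (c : ℕ∞) (R : Finset Request) (x t₀ : ℝ) : Prop :=
  s.Serves c R x t₀ ∧ ∀ s' : Schedule, s'.Serves c R x t₀ → s.finish ≤ s'.finish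

/-- Starting at time `t₀` in `x` with the requests in `L` on board, `s` delivers all of them and is
back in the origin at time `s.finish`. -/
def Schedule.Returns (s : Schedule) (L : Finset Request) (x t₀ : ℝ) : Prop :=
  s.MovesFrom x t₀ ∧ t₀ ≤ s.finish ∧
  (∀ r ∈ L, t₀ ≤ s.unload r ∧ s.pos (s.unload r) = r.dst ∧ s.unload r ≤ s.finish) ∧
  s.pos s.finish = 0

/-- `s` delivers the requests in `L` and returns to the origin in an optimal way. -/
def Schedule.IsShortestReturn (s : Schedule) (L : Finset Request) (x t₀ : ℝ) : Prop :=
  s.Returns L x t₀ ∧ ∀ s' : Schedule, s'.Returns L x t₀ → s.finish ≤ s'.finish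

/-- The completion time of the offline optimum for the requests in `R`: the server starts at time
`0` in the origin, knows all requests, and does not have to return. -/
noncomputable def opt (c : ℕ∞) (R : Finset Request) : ℝ :=
  sInf {T : ℝ | ∃ s : Schedule, s.Serves c R 0 0 ∧ s.finish = T}

/-- A deterministic online rule that selects one of the shortest schedules, and one of the optimal
ways to deliver and return. Besides the set of requests, the position and the current time, the
choice may depend on the list of all requests released so far. -/
structure TieBreaking (c : ℕ∞) where
  follow : List Request → Finset Request → ℝ → ℝ → Schedule
  follow_spec : ∀ (h : List Request) (R : Finset Request) (x t₀ : ℝ),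
    (∃ s : Schedule, s.IsShortest c R x t₀) → (follow h R x t₀).IsShortest c R x t₀
  ret : List Request → Finset Request → ℝ → ℝ → Schedule
  ret_spec : ∀ (h : List Request) (L : Finset Request) (x t₀ : ℝ),
    (∃ s : Schedule, s.IsShortestReturn L x t₀) → (ret h L x t₀).IsShortestReturn L x t₀

theorem TieBreaking.nonempty (c : ℕ∞) : Nonempty (TieBreaking c) := by
  classical
  exact ⟨{
    follow := fun _ R x t₀ => Classical.epsilon (h := ⟨⟨0, 0, 0, 0⟩⟩) (fun s => s.IsShortest c R x t₀)
    follow_spec := fun _ _ _ _ h => Classical.epsilon_spec_aux _ _ h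
    ret := fun _ L x t₀ => Classical.epsilon (h := ⟨⟨0, 0, 0, 0⟩⟩) (fun s => s.IsShortestReturn L x t₀)
    ret_spec := fun _ _ _ _ h => Classical.epsilon_spec_aux _ _ h }⟩

/-- What the server is currently doing. -/
inductive Command where
  /-- nothing; the server stays where it is -/
  | idle
  /-- `wait_until T` -/
  | wait (T : ℝ)
  /-- `deliver_and_return`, carried out as `s` -/
  | ret (s : Schedule)
  /-- `follow_schedule s`, where `s` serves the requests in `R` -/
  | follow (R : Finset Request) (s : Schedule)

/-- The time at which the execution of a command is completed. -/
def Command.finish? : Command → Option ℝ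
  | .idle => none
  | .wait T => some T
  | .ret s => some s.finish
  | .follow _ s => some s.finish

/-- A configuration of the simulation. The algorithm itself never looks at `future`. -/
structure Config where
  /-- current time `t` -/
  time : ℝ
  /-- current position of the server -/
  pos : ℝ
  /-- requests on board -/
  loaded : Finset Request
  /-- released requests that have not been loaded yet -/
  pending : Finset Request
  cmd : Command
  /-- all requests released so far, latest first -/
  released : List Request
  /-- requests that are still to be released, in the order of their release times -/
  future : List Request

/-- At time `0` the empty server stays in the origin and no request has been released. -/
def Config.init (σ : List Request) : Config where
  time := 0
  pos := 0
  loaded := ∅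
  pending := ∅
  cmd := .idle
  released := []
  future := σ

open Classical in
/-- Execute the current command up to time `τ`. -/
noncomputable def Config.advance (C : Config) (τ : ℝ) : Config :=
  match C.cmd with
  | .idle => { C with time := τ }
  | .wait _ => { C with time := τ }
  | .ret s =>
    { C with
      time := τ
      pos := s.pos τ
      loaded := C.loaded.filter (fun r => τ < s.unload r) }
  | .follow R s =>
    { C with
      time := τ
      pos := s.pos τ
      loaded := R.filter (fun r => s.load r ≤ τ ∧ τ < s.unload r)
      pending := C.pending.filter (fun r => ¬ (r ∈ R ∧ s.load r ≤ τ)) }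

open Classical in
/-- `Opt(t)` for the current time `t`. -/
noncomputable def Config.opt (c : ℕ∞) (C : Config) : ℝ :=
  DialARide.opt c C.released.toFinset

open Classical in
/-- The part "upon becoming idle" of `Lazy(α)`. -/
noncomputable def Config.whenIdle {c : ℕ∞} (tb : TieBreaking c) (α : ℝ) (C : Config) : Config :=
  if C.time < α * C.opt c then
    { C with cmd := .wait (α * C.opt c) }
  else if C.pending ≠ ∅ then
    { C with cmd := .follow C.pending (tb.follow C.released C.pending C.pos C.time) }
  else
    { C with cmd := .idle }

/-- The current command has been completed at time `e`. -/
noncomputable def Config.complete {c : ℕ∞} (tb : TieBreaking c) (α : ℝ) (C : Config) (e : ℝ) :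
    Config :=
  Config.whenIdle tb α { C.advance e with cmd := .idle }

open Classical in
/-- The execution of the current command up to the release of `r`, when `r` is registered. -/
noncomputable def Config.register (C : Config) (r : Request) (rest : List Request) : Config :=
  { C.advance r.release with
    pending := insert r (C.advance r.release).pending
    released := r :: C.released
    future := rest }

open Classical in
/-- The part "upon receiving request" of `Lazy(α)`, for a configuration in which the new request
has just been registered. If the current command is not replaced by `deliver_and_return`, it is
continued; a server that has no current command is idle and acts accordingly. -/
noncomputable def Config.uponRequest {c : ℕ∞} (tb : TieBreaking c) (α : ℝ) (C : Config) : Config :=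
  if ∃ s : Schedule, s.Returns C.loaded C.pos C.time ∧ s.finish ≤ α * C.opt c then
    { C with cmd := .ret (tb.ret C.released C.loaded C.pos C.time) }
  else
    match C.cmd with
    | .idle => C.whenIdle tb α
    | _ => C

open Classical in
/-- Go to the next event: the release of a request or the completion of the current command
(in this order, if they happen at the same time). -/
noncomputable def Config.step {c : ℕ∞} (tb : TieBreaking c) (α : ℝ) (C : Config) : Config :=
  match C.cmd.finish?, C.future with
  | none, [] => C
  | none, r :: rest => (C.register r rest).uponRequest tb α
  | some e, [] => C.complete tb α e
  | some e, r :: rest =>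
    if r.release ≤ e then (C.register r rest).uponRequest tb α else C.complete tb α e

/-- All requests have been released and served. -/
def Config.Done (C : Config) : Prop :=
  C.future = [] ∧ C.pending = ∅ ∧ C.loaded = ∅

/-- The completion time of `Lazy(α)` on `σ`: the first time at which all requests have been served
(`∞` if there is none). A shortest schedule is completed with the last delivery, so that it is
enough to look at the event times. -/
noncomputable def lazyTime {c : ℕ∞} (tb : TieBreaking c) (α : ℝ) (σ : List Request) : ℝ≥0∞ :=
  ⨅ (k : ℕ) (_ : ((Config.step tb α)^[k] (Config.init σ)).Done),
    ENNReal.ofReal ((Config.step tb α)^[k] (Config.init σ)).time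

open Classical in
/-- The strict competitive ratio `sup_σ Lazy(α)(σ) / Opt(σ)` on the line, for server capacity `c`
and tie-breaking rule `tb`. -/
noncomputable def lazyCompetitiveRatio {c : ℕ∞} (tb : TieBreaking c) (α : ℝ) : ℝ≥0∞ :=
  ⨆ (σ : List Request) (_ : IsRequestSequence σ),
    lazyTime tb α σ / ENNReal.ofReal (opt c σ.toFinset)

end DialARide

namespace DialARide

section

open Classical Filter Topology

variable {c : ℕ∞} {α : ℝ}

/-! ### Schedules and the offline optimum -/

/-! Each bound comes from an adversary that releases a request at a moment when `Lazy(α)` can no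
longer be back in the origin in time; letting a small delay `δ` tend to `0` gives the stated value.

For `α ≥ 1`, one request at the point `1` costs `α + 1` against an optimum of `1`. For the other
term, short rides to `1` and `-1` have optimum `3`, so the server starts at time `3α` and heads for
some `g = ±1`. Just afterwards, with the ride to `g` on board, a far point on the side of `g` is
requested. The server still ends its schedule in `-g` and crosses the line once more, while the
optimum, having visited `-g` first, is at the new point when it is released (`ratio_ge_of_one_le`).

For `α < 1`, the server is lured to `1`, and a point request at `0` and a ride from near `1 / 2` to
`1` appear behind it. From `1`, doing the ride first is shorter, so the server ends in `0`, and a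
late request at `1` makes it cross again. The optimum waits in the origin and serves everything in
one sweep to the right (`late_of_going_right`).

The online side is a symbolic execution: `Late` is pulled back event by event from the final
schedule to the initial configuration. The tie-breaking rule stays arbitrary; only forced features
of shortest schedules are used. -/

theorem Schedule.MovesFrom.abs_sub_le {s : Schedule} {x t₀ : ℝ} (h : s.MovesFrom x t₀) {t : ℝ}
    (ht : t₀ ≤ t) : |s.pos t - x| ≤ t - t₀ := by
  have := h.2 t t₀ ht le_rfl
  rwa [h.1, abs_of_nonneg (sub_nonneg.2 ht)] at this

theorem Schedule.MovesFrom.abs_sub_le_of_le {s : Schedule} {x t₀ : ℝ} (h : s.MovesFrom x t₀)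
    {t t' : ℝ} (ht : t₀ ≤ t) (htt' : t ≤ t') : |s.pos t' - s.pos t| ≤ t' - t := by
  have := h.2 t' t (ht.trans htt') ht
  rwa [abs_of_nonneg (sub_nonneg.2 htt')] at this

/-- If the requests are carried one after the other, any positive capacity suffices. -/
theorem Schedule.respectsCapacity_of_disjoint (hc : 1 ≤ c) {s : Schedule} {R : Finset Request}
    (hle : ∀ r ∈ R, s.load r ≤ s.unload r)
    (hdisj : ∀ r ∈ R, ∀ r' ∈ R, r ≠ r' → s.unload r ≤ s.load r' ∨ s.unload r' ≤ s.load r) :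
    s.RespectsCapacity c R := by
  constructor
  · intro t
    refine le_trans ?_ hc
    have : (R.filter (fun r => s.load r ≤ t ∧ t < s.unload r)).card ≤ 1 := by
      rw [Finset.card_le_one]
      intro a ha b hb
      simp only [Finset.mem_filter] at ha hb
      by_contra hab
      rcases hdisj a ha.1 b hb.1 hab with h | h <;> linarith [ha.2.1, ha.2.2, hb.2.1, hb.2.2]
    exact_mod_cast this
  · intro r hr
    have : R.filter (fun r' => s.load r' < s.load r ∧ s.load r < s.unload r') = ∅ := by
      rw [Finset.filter_eq_empty_iff]
      rintro r' hr' ⟨h1, h2⟩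
      have hne : r ≠ r' := by rintro rfl; exact lt_irrefl _ h1
      have := hle r hr
      rcases hdisj r hr r' hr' hne with h | h <;> linarith
    rw [this]
    simpa using lt_of_lt_of_le zero_lt_one hc

theorem opt_le_finish {R : Finset Request} {s : Schedule} (hs : s.Serves c R 0 0) :
    opt c R ≤ s.finish :=
  csInf_le ⟨0, by rintro _ ⟨s', hs', rfl⟩; exact hs'.2.1⟩ ⟨s, hs, rfl⟩

/-- The witness `s` matters: the real infimum of the empty set is `0`, so lower bounds need
feasibility. -/
theorem le_opt {R : Finset Request} {s : Schedule} (hs : s.Serves c R 0 0) {T : ℝ}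
    (h : ∀ s' : Schedule, s'.Serves c R 0 0 → T ≤ s'.finish) : T ≤ opt c R :=
  le_csInf ⟨_, s, hs, rfl⟩ (by rintro _ ⟨s', hs', rfl⟩; exact h s' hs')

theorem Schedule.Serves.add_abs_le_finish {R : Finset Request} {s : Schedule} {x t₀ : ℝ}
    (hs : s.Serves c R x t₀) {r : Request} (hr : r ∈ R) : t₀ + |r.dst - x| ≤ s.finish := by
  obtain ⟨hm, -, hR, -⟩ := hs
  obtain ⟨h1, h2, h3, h4, h5, h6⟩ := hR r hr
  have := hm.abs_sub_le (h1.trans h4)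
  rw [h5] at this
  linarith

/-- Stay in the origin until time `w`, then go to the right up to `ℓ`, carrying every request on
the way. -/
noncomputable def sweep (w ℓ : ℝ) : Schedule where
  pos t := max 0 (t - w)
  load r := w + r.src
  unload r := w + r.dst
  finish := w + ℓ

/-- The requests in `R` are carried by the schedule `sweep w ℓ`. -/
def SweepFeasible (R : Finset Request) (w ℓ : ℝ) : Prop :=
  (∀ r ∈ R, 0 ≤ r.src ∧ r.src ≤ r.dst ∧ r.dst ≤ ℓ ∧ r.release ≤ w + r.src) ∧
  (∀ r ∈ R, ∀ r' ∈ R, r ≠ r' → r.dst ≤ r'.src ∨ r'.dst ≤ r.src)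

theorem SweepFeasible.mono {R R' : Finset Request} {w ℓ : ℝ} (h : SweepFeasible R w ℓ)
    (hR : R' ⊆ R) : SweepFeasible R' w ℓ :=
  ⟨fun r hr => h.1 r (hR hr), fun r hr r' hr' => h.2 r (hR hr) r' (hR hr')⟩

theorem SweepFeasible.serves (hc : 1 ≤ c) {R : Finset Request} {w ℓ t₀ : ℝ} (ht₀ : t₀ ≤ w)
    (hℓ : 0 ≤ ℓ) (h : SweepFeasible R w ℓ) : (sweep w ℓ).Serves c R 0 t₀ := by
  refine ⟨⟨max_eq_left (by linarith), fun t t' _ _ => ?_⟩, by simp only [sweep]; linarith,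
    fun r hr => ?_, Schedule.respectsCapacity_of_disjoint hc (fun r hr => ?_)
    (fun r hr r' hr' hne => ?_)⟩
  · simp only [sweep]
    refine (abs_max_sub_max_le_max _ _ _ _).trans (max_le (by simp) (le_of_eq ?_))
    congr 1; ring
  · obtain ⟨h1, h2, h3, h4⟩ := h.1 r hr
    simp only [sweep]
    refine ⟨by linarith, h4, ?_, by linarith, ?_, by linarith⟩
    · rw [add_sub_cancel_left, max_eq_right h1]
    · rw [add_sub_cancel_left, max_eq_right (h1.trans h2)]
  · have := (h.1 r hr).2.1
    simp only [sweep]; linarith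
  · simp only [sweep]
    rcases h.2 r hr r' hr' hne with h | h
    · left; linarith
    · right; linarith

theorem SweepFeasible.opt_le (hc : 1 ≤ c) {R : Finset Request} {w ℓ : ℝ} (hw : 0 ≤ w)
    (hℓ : 0 ≤ ℓ) (h : SweepFeasible R w ℓ) : opt c R ≤ w + ℓ :=
  opt_le_finish (h.serves hc hw hℓ)

/-- A destination at distance `ℓ` forces at least `ℓ` units of travel, and a sweep without waiting
needs no more. -/
theorem SweepFeasible.isShortest (hc : 1 ≤ c) {R : Finset Request} {t₀ ℓ : ℝ} (hℓ : 0 ≤ ℓ)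
    (h : SweepFeasible R t₀ ℓ) {r : Request} (hr : r ∈ R) (hdst : r.dst = ℓ) :
    (sweep t₀ ℓ).IsShortest c R 0 t₀ := by
  refine ⟨h.serves hc le_rfl hℓ, fun s' hs' => ?_⟩
  have := hs'.add_abs_le_finish hr
  rwa [sub_zero, hdst, abs_of_nonneg hℓ] at this

theorem SweepFeasible.opt_eq (hc : 1 ≤ c) {R : Finset Request} {ℓ : ℝ} (hℓ : 0 ≤ ℓ)
    (h : SweepFeasible R 0 ℓ) {r : Request} (hr : r ∈ R) (hdst : r.dst = ℓ) : opt c R = ℓ := by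
  have hs := h.isShortest hc hℓ hr hdst
  refine le_antisymm (by simpa using h.opt_le hc le_rfl hℓ) (le_opt hs.1 fun s' hs' => ?_)
  simpa [sweep] using hs.2 s' hs'

/-- There is a shortest schedule for a single request at a point. -/
theorem exists_isShortest_singleton (hc : 1 ≤ c) (p t x t₀ : ℝ) (ht : t ≤ t₀) :
    ∃ s : Schedule, s.IsShortest c {⟨p, p, t⟩} x t₀ := by
  have hn : 0 ≤ |p - x| := abs_nonneg _
  refine ⟨⟨fun τ => if 0 ≤ p - x then x + (τ - t₀) else x - (τ - t₀), fun _ => t₀ + |p - x|,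
    fun _ => t₀ + |p - x|, t₀ + |p - x|⟩, ⟨⟨?_, ?_⟩, ?_, ?_, ?_⟩, ?_⟩
  · simp
  · intro τ τ' _ _
    dsimp only
    split_ifs
    · rw [show x + (τ - t₀) - (x + (τ' - t₀)) = τ - τ' by ring]
    · rw [show x - (τ - t₀) - (x - (τ' - t₀)) = τ' - τ by ring, abs_sub_comm]
  · dsimp only; linarith
  · intro r hr
    rw [Finset.mem_singleton] at hr
    subst hr
    have : (if 0 ≤ p - x then x + (t₀ + |p - x| - t₀) else x - (t₀ + |p - x| - t₀)) = p := by
      split_ifs with h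
      · rw [abs_of_nonneg h]; ring
      · rw [abs_of_neg (not_le.1 h)]; ring
    refine ⟨by dsimp only; linarith, by dsimp only; linarith, this, le_rfl, this, le_rfl⟩
  · refine Schedule.respectsCapacity_of_disjoint hc (fun r _ => le_rfl) (fun r _ r' _ _ => ?_)
    exact Or.inl le_rfl
  · intro s' hs'
    exact hs'.add_abs_le_finish (Finset.mem_singleton_self _)

/-- The shortest way to return of an empty server in the origin is to stay there. -/
theorem isShortestReturn_empty (t₀ : ℝ) :
    Schedule.IsShortestReturn ⟨fun _ => 0, fun _ => 0, fun _ => 0, t₀⟩ ∅ 0 t₀ :=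
  ⟨⟨⟨rfl, fun _ _ _ _ => by simp⟩, le_rfl, by simp, rfl⟩, fun _ hs' => hs'.2.1⟩

/-- A server that has to deliver `r` needs the time for going to `r.dst` and from there to the
origin. -/
theorem Schedule.Returns.le_finish {s : Schedule} {L : Finset Request} {x t₀ : ℝ}
    (hs : s.Returns L x t₀) {r : Request} (hr : r ∈ L) :
    t₀ + |r.dst - x| + |r.dst| ≤ s.finish := by
  obtain ⟨hm, -, hL, h0⟩ := hs
  obtain ⟨h1, h2, h3⟩ := hL r hr
  have h4 := hm.abs_sub_le h1
  have h5 := hm.abs_sub_le_of_le h1 h3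
  rw [h2] at h4
  rw [h0, h2, zero_sub, abs_neg] at h5
  linarith

theorem Schedule.Returns.add_abs_le_finish {s : Schedule} {L : Finset Request} {x t₀ : ℝ}
    (hs : s.Returns L x t₀) : t₀ + |x| ≤ s.finish := by
  have := hs.1.abs_sub_le hs.2.1
  rw [hs.2.2.2, zero_sub, abs_neg] at this
  linarith

/-! ### Executions of the algorithm -/

/-- From the configuration `C` on, the algorithm does not complete before time `T`. -/
def Late (tb : TieBreaking c) (α T : ℝ) (C : Config) : Prop :=
  ∀ k : ℕ, ((Config.step tb α)^[k] C).Done → T ≤ ((Config.step tb α)^[k] C).time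

variable {tb : TieBreaking c} {T : ℝ}

/-- This pulls a lower bound back through one event and is the basic move of every simulation below.
-/
theorem Late.of_step {C : Config} (hC : ¬ C.Done) (h : Late tb α T (C.step tb α)) :
    Late tb α T C := by
  intro k hk
  cases k with
  | zero => exact absurd hk hC
  | succ k => exact h k hk

theorem ofReal_div_le_lazyCompetitiveRatio {σ : List Request} (hσ : IsRequestSequence σ)
    (hT : Late tb α T (Config.init σ)) {O : ℝ} (hO : 0 < O) (hopt : opt c σ.toFinset ≤ O) :
    ENNReal.ofReal (T / O) ≤ lazyCompetitiveRatio tb α := by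
  have h1 : ENNReal.ofReal T ≤ lazyTime tb α σ :=
    le_iInf₂ fun k hk => ENNReal.ofReal_le_ofReal (hT k hk)
  rw [ENNReal.ofReal_div_of_pos hO]
  exact (ENNReal.div_le_div h1 (ENNReal.ofReal_le_ofReal hopt)).trans
    (le_iSup₂ (f := fun (σ : List Request) (_ : IsRequestSequence σ) =>
      lazyTime tb α σ / ENNReal.ofReal (opt c σ.toFinset)) σ hσ)

/-- The inequality is strict because a release at the very time of completion is processed first. -/
theorem Config.step_eq_complete {C : Config} {e : ℝ} (he : C.cmd.finish? = some e)
    (hfut : ∀ r ∈ C.future, e < r.release) : C.step tb α = C.complete tb α e := by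
  unfold Config.step
  rw [he]
  generalize hf : C.future = f at hfut
  cases f with
  | nil => rfl
  | cons r rest => exact if_neg (not_le.2 (hfut r (by simp)))

theorem Config.step_eq_uponRequest {C : Config} {r : Request} {rest : List Request}
    (hf : C.future = r :: rest) (he : ∀ e, C.cmd.finish? = some e → r.release ≤ e) :
    C.step tb α = (C.register r rest).uponRequest tb α := by
  unfold Config.step
  rw [hf]
  generalize C.cmd.finish? = o at he
  cases o with
  | none => rfl
  | some e => exact if_pos (he e rfl)

theorem Config.whenIdle_of_lt {C : Config} (h : C.time < α * C.opt c) :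
    C.whenIdle tb α = { C with cmd := .wait (α * C.opt c) } :=
  if_pos h

theorem Config.whenIdle_of_le {C : Config} (h : α * C.opt c ≤ C.time) (hp : C.pending.Nonempty) :
    C.whenIdle tb α =
      { C with cmd := .follow C.pending (tb.follow C.released C.pending C.pos C.time) } :=
  (if_neg (not_lt.2 h)).trans (if_pos hp.ne_empty)

theorem Config.whenIdle_of_pending_eq_empty {C : Config} (h : α * C.opt c ≤ C.time)
    (hp : C.pending = ∅) : C.whenIdle tb α = { C with cmd := .idle } :=
  (if_neg (not_lt.2 h)).trans (if_neg (not_not.2 hp))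

theorem Config.uponRequest_of_returns {C : Config}
    (h : ∃ s : Schedule, s.Returns C.loaded C.pos C.time ∧ s.finish ≤ α * C.opt c) :
    C.uponRequest tb α = { C with cmd := .ret (tb.ret C.released C.loaded C.pos C.time) } :=
  if_pos h

theorem Config.uponRequest_of_idle {C : Config} (hcmd : C.cmd = .idle)
    (h : ∀ s : Schedule, s.Returns C.loaded C.pos C.time → α * C.opt c < s.finish) :
    C.uponRequest tb α = C.whenIdle tb α := by
  unfold Config.uponRequest
  rw [if_neg (by rintro ⟨s, h1, h2⟩; exact absurd (h s h1) (not_lt.2 h2)), hcmd]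

theorem Config.uponRequest_of_follow {C : Config} {R : Finset Request} {s : Schedule}
    (hcmd : C.cmd = .follow R s)
    (h : ∀ s : Schedule, s.Returns C.loaded C.pos C.time → α * C.opt c < s.finish) :
    C.uponRequest tb α = C := by
  unfold Config.uponRequest
  rw [if_neg (by rintro ⟨s, h1, h2⟩; exact absurd (h s h1) (not_lt.2 h2)), hcmd]

/-- The state after the last request has been served: at time `T` or later, the server stays where
it is. -/
def Config.Served (T : ℝ) (C : Config) : Prop :=
  T ≤ C.time ∧ C.future = [] ∧ C.pending = ∅ ∧
    (C.cmd = .idle ∨ ∃ T', T ≤ T' ∧ C.cmd = .wait T')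

theorem Config.Served.whenIdle {C : Config} (h : C.Served T) : (C.whenIdle tb α).Served T := by
  obtain ⟨h1, h2, h3, -⟩ := h
  rcases lt_or_ge C.time (α * C.opt c) with h4 | h4
  · rw [Config.whenIdle_of_lt h4]
    exact ⟨h1, h2, h3, Or.inr ⟨_, h1.trans h4.le, rfl⟩⟩
  · rw [Config.whenIdle_of_pending_eq_empty h4 h3]
    exact ⟨h1, h2, h3, Or.inl rfl⟩

theorem Config.Served.step {C : Config} (h : C.Served T) : (C.step tb α).Served T := by
  obtain ⟨time, pos, loaded, pending, cmd, released, future⟩ := C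
  obtain ⟨h1, rfl, rfl, rfl | ⟨T', h4, rfl⟩⟩ := h
  · exact ⟨h1, rfl, rfl, Or.inl rfl⟩
  · rw [Config.step_eq_complete (e := T') rfl (by simp)]
    exact Config.Served.whenIdle ⟨h4, rfl, rfl, Or.inl rfl⟩

theorem Config.Served.late {C : Config} (h : C.Served T) : Late tb α T C := by
  intro k hk
  suffices h : ((Config.step tb α)^[k] C).Served T from h.1
  clear hk
  induction k with
  | zero => exact h
  | succ k ih =>
    rw [Function.iterate_succ_apply']
    exact ih.step

/-- The last schedule serves all remaining requests. -/
theorem late_of_last_schedule {t x : ℝ} {R L : Finset Request} {s : Schedule} {h : List Request}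
    (hR : R.Nonempty) {x₀ t₀ : ℝ} (hs : s.Serves c R x₀ t₀) (hT : T ≤ s.finish) :
    Late tb α T ⟨t, x, L, R, .follow R s, h, []⟩ := by
  refine Late.of_step (fun h => hR.ne_empty h.2.1) ?_
  rw [Config.step_eq_complete (e := s.finish) rfl (by simp)]
  refine (Config.Served.whenIdle ⟨hT, rfl, ?_, Or.inl rfl⟩).late
  change R.filter (fun r => ¬ (r ∈ R ∧ s.load r ≤ s.finish)) = ∅
  rw [Finset.filter_eq_empty_iff]
  intro r hr
  obtain ⟨_, _, _, h4, _, h6⟩ := hs.2.2.1 r hr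
  exact not_not.2 ⟨hr, h4.trans h6⟩

/-- A request that is released while the empty server rests in the origin and has to wait makes it
wait for the new value of `α * Opt`. -/
theorem late_of_release_at_origin {t : ℝ} {cmd : Command} {P : Finset Request}
    {h : List Request} {r : Request} {rest : List Request}
    (hcmd : cmd = .idle ∨ ∃ T', cmd = .wait T' ∧ r.release ≤ T')
    (hrest : ∀ r' ∈ rest, r.release < r'.release)
    (hopt : r.release < α * opt c (r :: h).toFinset)
    (hL : Late tb α T ⟨r.release, 0, ∅, insert r P, .wait (α * opt c (r :: h).toFinset),
      r :: h, rest⟩) :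
    Late tb α T ⟨t, 0, ∅, P, cmd, h, r :: rest⟩ := by
  -- The release triggers `deliver_and_return`, but from the origin with nothing on board every
  -- optimal return takes no time. Whatever the rule selects is therefore completed at once without
  -- a move.
  have hret := tb.ret_spec (r :: h) ∅ 0 r.release ⟨_, isShortestReturn_empty _⟩
  set s := tb.ret (r :: h) ∅ 0 r.release
  have hfin : s.finish = r.release :=
    le_antisymm (hret.2 _ (isShortestReturn_empty _).1) hret.1.2.1
  have hpos : s.pos r.release = 0 := hret.1.1.1
  refine Late.of_step (fun h => by simpa using h.1) ?_
  rw [Config.step_eq_uponRequest (r := r) (rest := rest) rfl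
    (by rcases hcmd with rfl | ⟨T', rfl, hle⟩ <;> simp [Command.finish?]; exact hle)]
  have hreg : Config.register ⟨t, 0, ∅, P, cmd, h, r :: rest⟩ r rest =
      ⟨r.release, 0, ∅, insert r P, cmd, r :: h, rest⟩ := by
    rcases hcmd with rfl | ⟨T', rfl, hle⟩ <;> rfl
  rw [hreg, Config.uponRequest_of_returns ⟨_, (isShortestReturn_empty _).1, hopt.le⟩]
  refine Late.of_step (fun h => Finset.insert_ne_empty r P h.2.1) ?_
  change Late tb α T (Config.step tb α ⟨r.release, 0, ∅, insert r P, .ret s, r :: h, rest⟩)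
  have hcmd' : Command.finish? (.ret s) = some r.release := congrArg some hfin
  rw [Config.step_eq_complete (C := ⟨r.release, 0, ∅, insert r P, .ret s, r :: h, rest⟩) hcmd' hrest,
    Config.complete]
  have hadv : Config.advance ⟨r.release, 0, ∅, insert r P, .ret s, r :: h, rest⟩ r.release =
      ⟨r.release, 0, ∅, insert r P, .ret s, r :: h, rest⟩ := by
    simp only [Config.advance, hpos, Finset.filter_empty]
  rw [hadv, Config.whenIdle_of_lt (C := ⟨r.release, 0, ∅, insert r P, .idle, r :: h, rest⟩) hopt]
  exact hL

/-- When the waiting time is over, the server starts to follow a schedule. -/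
theorem late_of_wait_over {t x : ℝ} {P L : Finset Request} {h future : List Request}
    (hP : P.Nonempty) (hfut : ∀ r ∈ future, α * opt c h.toFinset < r.release)
    (hL : Late tb α T ⟨α * opt c h.toFinset, x, L, P,
      .follow P (tb.follow h P x (α * opt c h.toFinset)), h, future⟩) :
    Late tb α T ⟨t, x, L, P, .wait (α * opt c h.toFinset), h, future⟩ := by
  refine Late.of_step (fun h => hP.ne_empty h.2.1) ?_
  rw [Config.step_eq_complete (e := α * opt c h.toFinset) rfl hfut, Config.complete,
    Config.whenIdle_of_le le_rfl hP]
  exact hL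

/-- If an idle server cannot be back in the origin in time and need not wait, it starts as soon as
a request is released. -/
theorem late_of_release_start {t x : ℝ} {L : Finset Request} {h : List Request} {r : Request}
    {rest : List Request}
    (hret : ∀ s : Schedule, s.Returns L x r.release → α * opt c (r :: h).toFinset < s.finish)
    (hopt : α * opt c (r :: h).toFinset ≤ r.release)
    (hL : Late tb α T ⟨r.release, x, L, {r}, .follow {r} (tb.follow (r :: h) {r} x r.release),
      r :: h, rest⟩) :
    Late tb α T ⟨t, x, L, ∅, .idle, h, r :: rest⟩ := by
  refine Late.of_step (fun h => by simpa using h.1) ?_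
  have hreg : Config.register ⟨t, x, L, ∅, .idle, h, r :: rest⟩ r rest =
      ⟨r.release, x, L, {r}, .idle, r :: h, rest⟩ := rfl
  rw [Config.step_eq_uponRequest (r := r) (rest := rest) rfl (by simp [Command.finish?]), hreg,
    Config.uponRequest_of_idle rfl hret,
    Config.whenIdle_of_le (C := ⟨r.release, x, L, {r}, .idle, r :: h, rest⟩) hopt
      (Finset.singleton_nonempty r)]
  exact hL

/-- A request after whose release the server cannot return in time does not interrupt the current schedule. -/
theorem late_of_release_during_schedule {t x : ℝ} {P L R : Finset Request} {h : List Request}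
    {s : Schedule} {r : Request} {rest : List Request} (hr : r.release ≤ s.finish)
    (hret : ∀ s' : Schedule, s'.Returns (R.filter (fun r' => s.load r' ≤ r.release ∧
      r.release < s.unload r')) (s.pos r.release) r.release →
      α * opt c (r :: h).toFinset < s'.finish)
    (hL : Late tb α T ⟨r.release, s.pos r.release,
      R.filter (fun r' => s.load r' ≤ r.release ∧ r.release < s.unload r'),
      insert r (P.filter (fun r' => ¬ (r' ∈ R ∧ s.load r' ≤ r.release))), .follow R s,
      r :: h, rest⟩) :
    Late tb α T ⟨t, x, L, P, .follow R s, h, r :: rest⟩ := by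
  refine Late.of_step (fun h => by simpa using h.1) ?_
  rw [Config.step_eq_uponRequest (r := r) (rest := rest) rfl
    (by simpa [Command.finish?] using hr), Config.uponRequest_of_follow (R := R) (s := s) rfl hret]
  exact hL

/-- A completed schedule is followed by the next one. -/
theorem late_of_schedule_completed {t x : ℝ} {P P' L R : Finset Request}
    {h future : List Request} {s : Schedule} (hfut : ∀ r ∈ future, s.finish < r.release)
    {x₀ t₀ : ℝ} (hs : s.Serves c R x₀ t₀) (hopt : α * opt c h.toFinset ≤ s.finish)
    (hP' : P'.Nonempty) (hP : P \ R = P')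
    (hL : Late tb α T ⟨s.finish, s.pos s.finish, ∅, P',
      .follow P' (tb.follow h P' (s.pos s.finish) s.finish), h, future⟩) :
    Late tb α T ⟨t, x, L, P, .follow R s, h, future⟩ := by
  have h1 : R.filter (fun r => s.load r ≤ s.finish ∧ s.finish < s.unload r) = ∅ := by
    rw [Finset.filter_eq_empty_iff]
    exact fun r hr h => absurd (hs.2.2.1 r hr).2.2.2.2.2 (not_le.2 h.2)
  have h2 : P.filter (fun r => ¬ (r ∈ R ∧ s.load r ≤ s.finish)) = P' := by
    rw [← hP]
    ext r
    simp only [Finset.mem_filter, Finset.mem_sdiff]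
    refine and_congr_right fun _ => not_congr ⟨fun h => h.1, fun h => ⟨h, ?_⟩⟩
    obtain ⟨_, _, _, h4, _, h6⟩ := hs.2.2.1 r h
    exact h4.trans h6
  refine Late.of_step (fun h => ?_) ?_
  · have h3 : P = ∅ := h.2.1
    rw [h3] at hP
    exact hP'.ne_empty (by simpa using hP.symm)
  have hadv : Config.advance ⟨t, x, L, P, .follow R s, h, future⟩ s.finish =
      ⟨s.finish, s.pos s.finish, ∅, P', .follow R s, h, future⟩ := by
    simp only [Config.advance, h1, h2]
  rw [Config.step_eq_complete (e := s.finish) rfl hfut, Config.complete, hadv,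
    Config.whenIdle_of_le (C := ⟨s.finish, s.pos s.finish, ∅, P', .idle, h, future⟩) hopt hP']
  exact hL

/-- The last schedule serves a single request at the point `p`. -/
theorem late_of_last_point (hc : 1 ≤ c) {t₀ x p t : ℝ} {L : Finset Request} {h : List Request}
    (ht : t ≤ t₀) (hT : T ≤ t₀ + |p - x|) :
    Late tb α T ⟨t₀, x, L, {⟨p, p, t⟩}, .follow {⟨p, p, t⟩} (tb.follow h {⟨p, p, t⟩} x t₀),
      h, []⟩ := by
  have hs := (tb.follow_spec h _ x t₀ (exists_isShortest_singleton hc p t x t₀ ht)).1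
  exact late_of_last_schedule (Finset.singleton_nonempty _) hs
    (hT.trans (hs.add_abs_le_finish (Finset.mem_singleton_self _)))

/-! ### The lower bound `1 + α` -/

/-- The release time `1 / 2` lies before `α`, so the server waits until `α` and then travels one
unit; the optimum reaches `1` at time `1`. -/
theorem ofReal_one_add_le_ratio (hc : 1 ≤ c) (hα : 1 ≤ α) :
    ENNReal.ofReal (1 + α) ≤ lazyCompetitiveRatio tb α := by
  set r : Request := ⟨1, 1, 1 / 2⟩ with hr
  have hfeas : SweepFeasible [r].toFinset 0 1 := by
    constructor <;> norm_num [hr]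
  have hopt : opt c [r].toFinset = 1 := hfeas.opt_eq hc zero_le_one (r := r) (by simp) rfl
  have hL : Late tb α (1 + α) (Config.init [r]) := by
    refine late_of_release_at_origin (Or.inl rfl) (by simp) ?_ ?_
    · rw [hopt]; simp only [hr]; linarith
    refine late_of_wait_over ⟨r, by simp⟩ (by simp) ?_
    rw [hopt, mul_one, insert_empty_eq]
    exact late_of_last_point hc (by linarith) (by norm_num; linarith)
  have := ofReal_div_le_lazyCompetitiveRatio
    ⟨by simp, by simp [hr], by simp⟩ hL one_pos hopt.le
  simpa using this

/-- The adversaries need a positive delay `δ`; their limit ratio is a bound because the competitive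
ratio is a supremum. -/
theorem ofReal_le_of_eventually_nhdsGT {f : ℝ → ℝ} {A : ℝ≥0∞} (hf : ContinuousAt f 0)
    (h : ∀ᶠ δ in 𝓝[>] (0 : ℝ), ENNReal.ofReal (f δ) ≤ A) : ENNReal.ofReal (f 0) ≤ A :=
  le_of_tendsto ((ENNReal.continuous_ofReal.tendsto _).comp
    (hf.tendsto.mono_left nhdsWithin_le_nhds)) h

/-! ### The lower bound for `α < 1` -/

/-- A server in `1` that has to carry a request from `1 / 2 + δ` to `1` and to visit `0` does the
latter at the end. -/
theorem Schedule.Serves.ride_then_origin {s : Schedule} {δ t t' t₀ : ℝ} (hδ : 0 < δ)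
    (hs : s.Serves c {⟨1 / 2 + δ, 1, t'⟩, ⟨0, 0, t⟩} 1 t₀) :
    t₀ + 2 - 2 * δ ≤ s.finish ∧ (s.finish ≤ t₀ + 2 - 2 * δ → s.pos s.finish = 0) := by
  obtain ⟨hm, -, hR, -⟩ := hs
  obtain ⟨a1, -, a3, a4, a5, a6⟩ := hR ⟨1 / 2 + δ, 1, t'⟩ (by simp)
  obtain ⟨b1, -, -, b4, b5, b6⟩ := hR ⟨0, 0, t⟩ (by simp)
  generalize s.load ⟨1 / 2 + δ, 1, t'⟩ = l at *
  generalize s.unload ⟨1 / 2 + δ, 1, t'⟩ = u at *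
  generalize s.load ⟨0, 0, t⟩ = l' at *
  generalize s.unload ⟨0, 0, t⟩ = v at *
  dsimp only at a3 a5 b5
  -- If the ride is delivered first, the path `1 → 1 / 2 + δ → 1 → 0` has length `2 - 2 * δ`.
  -- Otherwise `1 → 0 → 1` has length `2`, which is too long for the second claim.
  rcases le_or_gt u v with h | h
  · have h1 := abs_le.1 (hm.abs_sub_le a1)
    have h2 := abs_le.1 (hm.abs_sub_le_of_le a1 a4)
    have h3 := abs_le.1 (hm.abs_sub_le_of_le (a1.trans a4) h)
    rw [a3] at h1
    rw [a3, a5] at h2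
    rw [a5, b5] at h3
    refine ⟨by linarith [h1.1, h2.2, h3.1], fun h4 => ?_⟩
    rw [show s.finish = v by linarith [h1.1, h2.2, h3.1], b5]
  · have h1 := abs_le.1 (hm.abs_sub_le (b1.trans b4))
    have h2 := abs_le.1 (hm.abs_sub_le_of_le (b1.trans b4) h.le)
    rw [b5] at h1
    rw [a5, b5] at h2
    constructor
    · linarith [h1.1, h2.2]
    · intro h4; linarith [h1.1, h2.2]

/-- `follow_spec` says something only where a shortest schedule exists, so one has to be exhibited.
-/
theorem exists_isShortest_ride_then_origin (hc : 1 ≤ c) {δ t t' t₀ : ℝ} (hδ : 0 < δ)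
    (hδ' : δ < 1 / 2) (ht : t ≤ t₀) (ht' : t' ≤ t₀) :
    ∃ s : Schedule, s.IsShortest c {⟨1 / 2 + δ, 1, t'⟩, ⟨0, 0, t⟩} 1 t₀ ∧
      s.finish = t₀ + 2 - 2 * δ := by
  set a := 1 / 2 - δ with ha
  have ha0 : 0 < a := by linarith
  -- The zigzag `1 → 1 - a → 1 → 0` as a lattice combination of lines of slope `±1`; it turns at
  -- times `t₀ + a` and `t₀ + 2 * a`.
  refine ⟨⟨fun τ => min (max (1 - (τ - t₀)) (1 - 2 * a + (τ - t₀))) (1 + 2 * a - (τ - t₀)),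
    fun r => if r.src = 0 then t₀ + 2 * a + 1 else t₀ + a,
    fun r => if r.src = 0 then t₀ + 2 * a + 1 else t₀ + 2 * a, t₀ + 2 - 2 * δ⟩,
    ⟨⟨⟨?_, fun τ τ' _ _ => ?_⟩, ?_, fun r hr => ?_,
      Schedule.respectsCapacity_of_disjoint hc (fun r hr => ?_) (fun r hr r' hr' hne => ?_)⟩,
      fun s' hs' => (hs'.ride_then_origin hδ).1⟩, rfl⟩
  · dsimp only
    rw [sub_self, max_eq_left (by linarith), min_eq_left (by linarith), sub_zero]
  · refine (abs_min_sub_min_le_max _ _ _ _).trans (max_le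
      ((abs_max_sub_max_le_max _ _ _ _).trans (max_le (le_of_eq ?_) (le_of_eq ?_))) (le_of_eq ?_))
    · rw [abs_sub_comm]; congr 1; ring
    · congr 1; ring
    · rw [abs_sub_comm]; congr 1; ring
  · dsimp only; linarith
  · have h2 : (1 / 2 + δ : ℝ) ≠ 0 := by linarith
    simp only [Finset.mem_insert, Finset.mem_singleton] at hr
    rcases hr with rfl | rfl
    · simp only [if_neg h2]
      refine ⟨by linarith, by linarith, ?_, by linarith, ?_, by linarith⟩
      · rw [max_eq_left (by linarith), min_eq_left (by linarith)]; linarith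
      · rw [max_eq_right (by linarith), min_eq_left (by linarith)]; linarith
    · simp only [if_true]
      refine ⟨by linarith, by linarith, ?_, le_rfl, ?_, by linarith⟩
      all_goals rw [max_eq_right (by linarith), min_eq_right (by linarith)]; linarith
  · dsimp only; split_ifs <;> linarith
  · have h2 : (1 / 2 + δ : ℝ) ≠ 0 := by linarith
    simp only [Finset.mem_insert, Finset.mem_singleton] at hr hr'
    rcases hr with rfl | rfl <;> rcases hr' with rfl | rfl
    · exact absurd rfl hne
    · left; simp only [if_neg h2, if_true]; linarith
    · right; simp only [if_neg h2, if_true]; linarith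
    · exact absurd rfl hne

/-- The server has started at time `s` to go from the origin to `1`, without a possibility to
return in time. Then it has to go to the origin and to `1` once more. -/
theorem late_of_going_right (hc : 1 ≤ c) {s δ : ℝ} (hs : 0 ≤ s) (hδ : 0 < δ) (hδ' : δ < 1 / 4)
    (hα : 0 ≤ α) (hαs : α * (s + 1 + δ) < s + 1) {h : List Request}
    (hfeas : SweepFeasible ((⟨1, 1, s + 1 + δ⟩ :: ⟨1 / 2 + δ, 1, s + 2 * δ⟩ ::
      ⟨0, 0, s + δ⟩ :: h : List Request)).toFinset (s + δ) 1)
    {R : Finset Request} {S : Schedule} (hS : S.Serves c R 0 s) (hfin : S.finish = s + 1)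
    (hend : S.pos (s + 1) = 1) (hrel : ∀ r ∈ R, r.release < s + δ)
    (hret : ∀ t, s + δ ≤ t → t ≤ s + 2 * δ → ∀ S' : Schedule,
      S'.Returns (R.filter (fun r => S.load r ≤ t ∧ t < S.unload r)) (S.pos t) t →
        α * (s + 1 + δ) < S'.finish) {t x : ℝ} {L : Finset Request} :
    Late tb α (s + 4 - 2 * δ) ⟨t, x, L, R, .follow R S, h,
      [⟨0, 0, s + δ⟩, ⟨1 / 2 + δ, 1, s + 2 * δ⟩, ⟨1, 1, s + 1 + δ⟩]⟩ := by
  -- One offline sweep that leaves the origin at time `s + δ` bounds the optimum at every stage,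
  -- hence all return deadlines at once.
  have hopt : ∀ R' ⊆ ((⟨1, 1, s + 1 + δ⟩ :: ⟨1 / 2 + δ, 1, s + 2 * δ⟩ ::
      ⟨0, 0, s + δ⟩ :: h : List Request)).toFinset, α * opt c R' ≤ α * (s + 1 + δ) := by
    intro R' hR'
    refine mul_le_mul_of_nonneg_left ?_ hα
    have := (hfeas.mono hR').opt_le hc (by linarith) zero_le_one
    linarith
  set r₃ : Request := ⟨0, 0, s + δ⟩ with hr₃
  set r₄ : Request := ⟨1 / 2 + δ, 1, s + 2 * δ⟩ with hr₄
  set r₅ : Request := ⟨1, 1, s + 1 + δ⟩ with hr₅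
  have h₃ : r₃ ∉ R := fun h => lt_irrefl _ (hrel _ h)
  have h₄ : r₄ ∉ R := fun h => by have := hrel _ h; simp only [hr₄] at this; linarith
  have sub₃ : (r₃ :: h).toFinset ⊆ (r₅ :: r₄ :: r₃ :: h).toFinset := by
    intro r hr; simp only [List.mem_toFinset, List.mem_cons] at hr ⊢; tauto
  have sub₄ : (r₄ :: r₃ :: h).toFinset ⊆ (r₅ :: r₄ :: r₃ :: h).toFinset := by
    intro r hr; simp only [List.mem_toFinset, List.mem_cons] at hr ⊢; tauto
  refine late_of_release_during_schedule (by rw [hfin]; simp only [hr₃]; linarith)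
    (fun S' hS' => (hopt _ sub₃).trans_lt
      (hret _ (by simp only [hr₃]; linarith) (by simp only [hr₃]; linarith) S' hS')) ?_
  refine late_of_release_during_schedule (by rw [hfin]; simp only [hr₄]; linarith)
    (fun S' hS' => (hopt _ sub₄).trans_lt
      (hret _ (by simp only [hr₄]; linarith) (by simp only [hr₄]; linarith) S' hS')) ?_
  refine late_of_schedule_completed (P' := {r₄, r₃}) ?_ hS ?_ (by simp) ?_ ?_
  · rw [hfin]
    intro r hr
    rw [List.mem_singleton] at hr
    rw [hr]; simp only [hr₅]; linarith
  · rw [hfin]; linarith [hopt _ sub₄]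
  · ext r
    simp only [Finset.mem_sdiff, Finset.mem_insert, Finset.mem_filter, Finset.mem_singleton]
    constructor
    · tauto
    · rintro (rfl | rfl) <;> tauto
  rw [hfin, hend]
  obtain ⟨S₀, hS₀, hS₀f⟩ := exists_isShortest_ride_then_origin (c := c) hc (δ := δ) (t := s + δ)
    (t' := s + 2 * δ) (t₀ := s + 1) hδ (by linarith) (by linarith) (by linarith)
  have hS₁ := tb.follow_spec (r₄ :: r₃ :: h) {r₄, r₃} 1 (s + 1) ⟨S₀, hS₀⟩
  generalize tb.follow (r₄ :: r₃ :: h) {r₄, r₃} 1 (s + 1) = S₁ at hS₁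
  obtain ⟨h1, h2⟩ := hS₁.1.ride_then_origin hδ
  have h3 : S₁.finish ≤ s + 1 + 2 - 2 * δ := hS₀f ▸ hS₁.2 S₀ hS₀.1
  have h4 := h2 h3
  -- The server left `1` only `δ` ago, so it is at `1 - δ` or further right and cannot be back
  -- before time `s + 2`.
  refine late_of_release_during_schedule (by simp only [hr₅]; linarith)
    (fun S' hS' => (hopt _ subset_rfl).trans_lt ?_) ?_
  · have h5 := abs_le.1 (hS₁.1.1.abs_sub_le (t := r₅.release) (by simp only [hr₅]; linarith))
    have h6 := hS'.add_abs_le_finish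
    have h7 := le_abs_self (S₁.pos r₅.release)
    have h8 : r₅.release = s + 1 + δ := rfl
    linarith [h5.1]
  refine late_of_schedule_completed (P' := {r₅}) (by simp) hS₁.1 ?_ (by simp) ?_ ?_
  · linarith [hopt _ subset_rfl]
  · have h₅₃ : r₅ ≠ r₃ := fun h => by
      have := congrArg Request.src h
      simp [hr₅, hr₃] at this
    have h₅₄ : r₅ ≠ r₄ := fun h => by
      have := congrArg Request.release h
      simp only [hr₅, hr₄] at this
      linarith
    ext r
    simp only [Finset.mem_sdiff, Finset.mem_insert, Finset.mem_filter, Finset.mem_singleton]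
    constructor
    · tauto
    · rintro rfl; tauto
  rw [h4]
  refine late_of_last_point hc (by linarith) ?_
  norm_num
  linarith

/-- The ride `r₁` from `δ` to `1 / 2` blocks an early return: once loaded, it has to be delivered
first. The point `r₂` raises the optimum to `1` and draws the server to `1`; `4 * δ < α` lets it
appear before the first wait, until `α / 2`, is over. -/
theorem ratio_ge_of_pos_of_lt_one (hc : 1 ≤ c) (hα : 0 < α) (hα1 : α < 1) {δ : ℝ} (hδ : 0 < δ)
    (hδ' : δ < 1 / 4) (hδα : 4 * δ < α) (hαδ : α * (α + 1 + δ) < α + 1) :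
    ENNReal.ofReal ((α + 4 - 2 * δ) / (α + 1 + δ)) ≤ lazyCompetitiveRatio tb α := by
  set r₁ : Request := ⟨δ, 1 / 2, δ⟩ with hr₁
  set r₂ : Request := ⟨1, 1, 2 * δ⟩ with hr₂
  set r₃ : Request := ⟨0, 0, α + δ⟩ with hr₃
  set r₄ : Request := ⟨1 / 2 + δ, 1, α + 2 * δ⟩ with hr₄
  set r₅ : Request := ⟨1, 1, α + 1 + δ⟩ with hr₅
  have hfeas : SweepFeasible ([r₅, r₄, r₃, r₂, r₁].toFinset) (α + δ) 1 := by
    simp only [SweepFeasible, List.mem_toFinset, List.mem_cons, List.not_mem_nil, or_false]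
    constructor
    · rintro r (rfl | rfl | rfl | rfl | rfl) <;> refine ⟨?_, ?_, ?_, ?_⟩ <;>
        simp only [hr₁, hr₂, hr₃, hr₄, hr₅] <;> linarith
    · rintro r (rfl | rfl | rfl | rfl | rfl) r' (rfl | rfl | rfl | rfl | rfl) hne <;>
        first
        | exact absurd rfl hne
        | (left; simp only [hr₁, hr₂, hr₃, hr₄, hr₅]; linarith)
        | (right; simp only [hr₁, hr₂, hr₃, hr₄, hr₅]; linarith)
  have hfeas₂ : ∀ w, 0 ≤ w → SweepFeasible ([r₂, r₁].toFinset) w 1 := by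
    intro w hw
    simp only [SweepFeasible, List.mem_toFinset, List.mem_cons, List.not_mem_nil, or_false]
    constructor
    · rintro r (rfl | rfl) <;> refine ⟨?_, ?_, ?_, ?_⟩ <;> simp only [hr₁, hr₂] <;> linarith
    · rintro r (rfl | rfl) r' (rfl | rfl) hne <;>
        first
        | exact absurd rfl hne
        | (left; simp only [hr₁, hr₂]; linarith)
        | (right; simp only [hr₁, hr₂]; linarith)
  have hfeas₁ : SweepFeasible ([r₁].toFinset) 0 (1 / 2) := by
    constructor <;> simp [hr₁]; constructor <;> linarith
  have hopt₂ : opt c [r₂, r₁].toFinset = 1 :=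
    (hfeas₂ 0 le_rfl).opt_eq hc zero_le_one (r := r₂) (by simp) rfl
  have hopt₁ : opt c [r₁].toFinset = 1 / 2 :=
    hfeas₁.opt_eq hc (by norm_num) (r := r₁) (by simp) rfl
  have hL : Late tb α (α + 4 - 2 * δ) (Config.init [r₁, r₂, r₃, r₄, r₅]) := by
    refine late_of_release_at_origin (Or.inl rfl) ?_ ?_ ?_
    · simp only [List.mem_cons, List.not_mem_nil, or_false]
      rintro r (rfl | rfl | rfl | rfl) <;> simp only [hr₁, hr₂, hr₃, hr₄, hr₅] <;> linarith
    · rw [hopt₁]; simp only [hr₁]; linarith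
    refine late_of_release_at_origin (Or.inr ⟨_, rfl, ?_⟩) ?_ ?_ ?_
    · rw [hopt₁]; simp only [hr₂]; linarith
    · simp only [List.mem_cons, List.not_mem_nil, or_false]
      rintro r (rfl | rfl | rfl) <;> simp only [hr₂, hr₃, hr₄, hr₅] <;> linarith
    · rw [hopt₂]; simp only [hr₂]; linarith
    refine late_of_wait_over (by simp) ?_ ?_
    · rw [hopt₂]
      simp only [List.mem_cons, List.not_mem_nil, or_false]
      rintro r (rfl | rfl | rfl) <;> simp only [hr₃, hr₄, hr₅] <;> linarith
    rw [hopt₂, mul_one, insert_empty_eq]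
    have hR : ([r₂, r₁].toFinset : Finset Request) = {r₂, r₁} := by simp
    have hS₀ := (hfeas₂ α hα.le).isShortest hc zero_le_one (r := r₂) (by simp) rfl
    rw [hR] at hS₀
    have hS := tb.follow_spec [r₂, r₁] {r₂, r₁} 0 α ⟨_, hS₀⟩
    generalize tb.follow [r₂, r₁] {r₂, r₁} 0 α = S at hS
    have hfin : S.finish ≤ α + 1 := hS.2 _ hS₀.1
    obtain ⟨a1, -, a3, a4, a5, a6⟩ := hS.1.2.2.1 r₁ (by simp)
    obtain ⟨b1, -, b3, b4, b5, b6⟩ := hS.1.2.2.1 r₂ (by simp)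
    have hm := hS.1.1
    have c1 := abs_le.1 (hm.abs_sub_le (b1.trans b4))
    have c2 := abs_le.1 (hm.abs_sub_le (a1.trans a4))
    rw [b5] at c1
    rw [a5] at c2
    -- The schedule has no slack: reaching `1` at time `α + 1` forces `r₁` to be loaded by `α + δ`,
    -- and its destination cannot be reached before `α + 1 / 2`.
    have hu : S.unload r₂ = α + 1 := by simp only [hr₂] at *; linarith [c1.2]
    have c3 := abs_le.1 (hm.abs_sub_le_of_le (t' := α + 1) a1 (by linarith))
    rw [a3, ← hu, b5, hu] at c3
    simp only [hr₁, hr₂] at c1 c2 c3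
    refine late_of_going_right hc hα.le hδ hδ' hα.le hαδ hfeas hS.1 (by linarith) ?_ ?_ ?_
    · rw [← hu, b5]
    · simp only [Finset.mem_insert, Finset.mem_singleton]
      rintro r (rfl | rfl) <;> simp only [hr₁, hr₂] <;> linarith
    · intro t ht ht' S' hS'
      have hmem : r₁ ∈ ({r₂, r₁} : Finset Request).filter
          (fun r => S.load r ≤ t ∧ t < S.unload r) := by
        simp only [Finset.mem_filter, Finset.mem_insert, Finset.mem_singleton, or_true, true_and]
        constructor <;> simp only [hr₁] <;> linarith [c2.2, c3.2]
      -- Delivering `r₁` in `1 / 2` and coming back takes until `α + 1` at least, since the server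
      -- is no further right than `t - α`.
      have h1 := hS'.le_finish hmem
      have h2 := abs_le.1 (hm.abs_sub_le (t := t) (by linarith))
      simp only [hr₁] at h1
      have h3 := le_abs_self (1 / 2 - S.pos t)
      have h4 : |(1 / 2 : ℝ)| = 1 / 2 := abs_of_pos (by norm_num)
      linarith [h2.2]
  refine ofReal_div_le_lazyCompetitiveRatio ⟨by simp, ?_, ?_⟩ hL (by linarith) ?_
  · simp only [List.mem_cons, List.not_mem_nil, or_false]
    rintro r (rfl | rfl | rfl | rfl | rfl) <;> simp only [hr₁, hr₂, hr₃, hr₄, hr₅] <;> linarith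
  · simp only [List.pairwise_cons, List.mem_cons, List.not_mem_nil, or_false, List.Pairwise.nil,
      forall_eq_or_imp, forall_eq, hr₁, hr₂, hr₃, hr₄, hr₅]
    refine ⟨⟨?_, ?_, ?_, ?_⟩, ⟨?_, ?_, ?_⟩, ⟨?_, ?_⟩, ?_, ?_, trivial⟩ <;> first | linarith | simp
  · have := (hfeas.mono (R' := [r₁, r₂, r₃, r₄, r₅].toFinset) (by
      intro r hr; simp only [List.mem_toFinset, List.mem_cons] at hr ⊢; tauto)).opt_le hc
      (by linarith) zero_le_one
    linarith

/-- For `α = 0` the server starts at the first release, so two requests cannot be collected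
beforehand. No blocking ride is needed either, because the return deadline is always `0`. -/
theorem ratio_zero_ge (hc : 1 ≤ c) {δ : ℝ} (hδ : 0 < δ) (hδ' : δ < 1 / 4) :
    ENNReal.ofReal ((4 - δ) / (1 + 2 * δ)) ≤ lazyCompetitiveRatio tb 0 := by
  set r₁ : Request := ⟨1, 1, δ⟩ with hr₁
  set r₃ : Request := ⟨0, 0, δ + δ⟩ with hr₃
  set r₄ : Request := ⟨1 / 2 + δ, 1, δ + 2 * δ⟩ with hr₄
  set r₅ : Request := ⟨1, 1, δ + 1 + δ⟩ with hr₅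
  have hfeas : SweepFeasible ([r₅, r₄, r₃, r₁].toFinset) (δ + δ) 1 := by
    simp only [SweepFeasible, List.mem_toFinset, List.mem_cons, List.not_mem_nil, or_false]
    constructor
    · rintro r (rfl | rfl | rfl | rfl) <;> refine ⟨?_, ?_, ?_, ?_⟩ <;>
        simp only [hr₁, hr₃, hr₄, hr₅] <;> linarith
    · rintro r (rfl | rfl | rfl | rfl) r' (rfl | rfl | rfl | rfl) hne <;>
        first
        | exact absurd rfl hne
        | (left; simp only [hr₁, hr₃, hr₄, hr₅]; linarith)
        | (right; simp only [hr₁, hr₃, hr₄, hr₅]; linarith)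
  have hfeas₁ : SweepFeasible {r₁} δ 1 := by
    constructor <;> simp [hr₁]
  have hL : Late tb 0 (4 - δ) (Config.init [r₁, r₃, r₄, r₅]) := by
    refine late_of_release_start (fun S hS => ?_) (by rw [zero_mul]; exact hδ.le) ?_
    · rw [zero_mul]; exact hδ.trans_le hS.2.1
    have hS₀ := hfeas₁.isShortest hc zero_le_one (r := r₁) (by simp) rfl
    have hS := tb.follow_spec [r₁] {r₁} 0 δ ⟨_, hS₀⟩
    change Late tb 0 (4 - δ) ⟨δ, 0, ∅, {r₁}, .follow {r₁} (tb.follow [r₁] {r₁} 0 δ), [r₁],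
      [r₃, r₄, r₅]⟩
    generalize tb.follow [r₁] {r₁} 0 δ = S at hS
    have hfin : S.finish ≤ δ + 1 := hS.2 _ hS₀.1
    obtain ⟨a1, -, a3, a4, a5, a6⟩ := hS.1.2.2.1 r₁ (by simp)
    have c1 := abs_le.1 (hS.1.1.abs_sub_le (a1.trans a4))
    rw [a5] at c1
    have hu : S.unload r₁ = δ + 1 := by simp only [hr₁] at *; linarith [c1.2]
    have := late_of_going_right (tb := tb) (α := 0) (t := δ) (x := 0) (L := ∅) hc hδ.le hδ hδ'
      le_rfl (by linarith) hfeas hS.1 (by linarith) (by rw [← hu, a5]) ?_ ?_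
    · rwa [show δ + 4 - 2 * δ = 4 - δ by ring] at this
    · simp only [Finset.mem_singleton]
      rintro r rfl
      simp only [hr₁]; linarith
    · intro t ht _ S' hS'
      linarith [hS'.2.1]
  refine ofReal_div_le_lazyCompetitiveRatio ⟨by simp, ?_, ?_⟩ hL (by linarith) ?_
  · simp only [List.mem_cons, List.not_mem_nil, or_false]
    rintro r (rfl | rfl | rfl | rfl) <;> simp only [hr₁, hr₃, hr₄, hr₅] <;> linarith
  · simp only [List.pairwise_cons, List.mem_cons, List.not_mem_nil, or_false, List.Pairwise.nil,
      forall_eq_or_imp, forall_eq, hr₁, hr₃, hr₄, hr₅]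
    refine ⟨⟨?_, ?_, ?_⟩, ⟨?_, ?_⟩, ?_, ?_, trivial⟩ <;> first | linarith | simp
  · have := (hfeas.mono (R' := [r₁, r₃, r₄, r₅].toFinset) (by
      intro r hr; simp only [List.mem_toFinset, List.mem_cons] at hr ⊢; tauto)).opt_le hc
      (by linarith) zero_le_one
    linarith

theorem ofReal_le_ratio_of_lt_one (hc : 1 ≤ c) (hα : 0 ≤ α) (hα1 : α < 1) :
    ENNReal.ofReal (1 + 3 / (α + 1)) ≤ lazyCompetitiveRatio tb α := by
  rcases hα.eq_or_lt with rfl | hα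
  · have h := ofReal_le_of_eventually_nhdsGT (A := lazyCompetitiveRatio tb 0)
      (f := fun δ => (4 - δ) / (1 + 2 * δ))
      (ContinuousAt.div (by fun_prop) (by fun_prop) (by norm_num)) (by
        filter_upwards [Ioo_mem_nhdsGT (show (0 : ℝ) < 1 / 4 by norm_num)] with δ hδ
        exact ratio_zero_ge hc hδ.1 hδ.2)
    convert h using 2
    norm_num
  · have hb : 0 < min (1 / 4) (min (α / 4) (1 - α)) :=
      lt_min (by norm_num) (lt_min (by linarith) (by linarith))
    have h := ofReal_le_of_eventually_nhdsGT (A := lazyCompetitiveRatio tb α)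
      (f := fun δ => (α + 4 - 2 * δ) / (α + 1 + δ))
      (ContinuousAt.div (by fun_prop) (by fun_prop) (by linarith)) (by
        filter_upwards [Ioo_mem_nhdsGT hb] with δ hδ
        obtain ⟨h1, h2⟩ := hδ
        obtain ⟨h3, h4⟩ := lt_min_iff.1 h2
        obtain ⟨h5, h6⟩ := lt_min_iff.1 h4
        exact ratio_ge_of_pos_of_lt_one hc hα hα1 h1 h3 (by linarith) (by nlinarith))
    convert h using 2
    field_simp
    ring

/-! ### The lower bound `2 + 2 / (3 * α)` -/

/-- Go from the origin to `-g` and then in the direction of `g`, where `g` is `1` or `-1`. Requests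
with destination on the side of `-g` are carried on the way to `-g`, the others thereafter. -/
noncomputable def vee (g t₀ F : ℝ) : Schedule where
  pos t := g * (|t - t₀ - 1| - 1)
  load r := if g * r.dst < 0 then t₀ - g * r.src else t₀ + 2 + g * r.src
  unload r := if g * r.dst < 0 then t₀ - g * r.dst else t₀ + 2 + g * r.dst
  finish := F

/-- The alternatives in `hR` are the two legs: a point `x` is passed at time `t₀ - g * x` on the way
to `-g`, and at `t₀ + 2 + g * x` after the return through the origin. Multiplying by `g` treats both
orientations together. -/
theorem vee_serves (hc : 1 ≤ c) {R : Finset Request} {g t₀ F : ℝ} (hg : g = 1 ∨ g = -1)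
    (hF : t₀ ≤ F)
    (hR : ∀ r ∈ R, (g * r.dst < 0 ∧ -1 ≤ g * r.dst ∧ g * r.dst ≤ g * r.src ∧ g * r.src ≤ 0 ∧
        r.release ≤ t₀ - g * r.src ∧ t₀ + 1 ≤ F) ∨
      (0 ≤ g * r.src ∧ g * r.src ≤ g * r.dst ∧ t₀ + 2 + g * r.dst ≤ F ∧
        r.release ≤ t₀ + 2 + g * r.src))
    (hdisj : ∀ r ∈ R, ∀ r' ∈ R, r ≠ r' → (vee g t₀ F).unload r ≤ (vee g t₀ F).load r' ∨
      (vee g t₀ F).unload r' ≤ (vee g t₀ F).load r) :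
    (vee g t₀ F).Serves c R 0 t₀ := by
  have hgg : g * g = 1 := by rcases hg with rfl | rfl <;> norm_num
  have hmain : ∀ r ∈ R, t₀ ≤ (vee g t₀ F).load r ∧ r.release ≤ (vee g t₀ F).load r ∧
      (vee g t₀ F).pos ((vee g t₀ F).load r) = r.src ∧
      (vee g t₀ F).load r ≤ (vee g t₀ F).unload r ∧
      (vee g t₀ F).pos ((vee g t₀ F).unload r) = r.dst ∧
      (vee g t₀ F).unload r ≤ (vee g t₀ F).finish := by
    intro r hr
    have left : ∀ x, -1 ≤ g * x → g * (|t₀ - g * x - t₀ - 1| - 1) = x := fun x hx => by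
      rw [abs_of_nonpos (by linarith)]
      linear_combination x * hgg
    have right : ∀ x, 0 ≤ g * x → g * (|t₀ + 2 + g * x - t₀ - 1| - 1) = x := fun x hx => by
      rw [abs_of_nonneg (by linarith)]
      linear_combination x * hgg
    rcases hR r hr with ⟨h1, h2, h3, h4, h5, h6⟩ | ⟨h1, h2, h3, h4⟩
    · simp only [vee, if_pos h1]
      exact ⟨by linarith, h5, left _ (h2.trans h3), by linarith, left _ h2, by linarith⟩
    · simp only [vee, if_neg (not_lt.2 (h1.trans h2))]
      exact ⟨by linarith, h4, right _ h1, by linarith, right _ (h1.trans h2), h3⟩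
  refine ⟨⟨by simp [vee], fun t t' _ _ => ?_⟩, hF, hmain,
    Schedule.respectsCapacity_of_disjoint hc (fun r hr => (hmain r hr).2.2.2.1) hdisj⟩
  have hg1 : |g| = 1 := by rcases hg with rfl | rfl <;> norm_num
  simp only [vee]
  rw [← mul_sub, abs_mul, hg1, one_mul,
    show |t - t₀ - 1| - 1 - (|t' - t₀ - 1| - 1) = |t - t₀ - 1| - |t' - t₀ - 1| by ring]
  refine (abs_abs_sub_abs_le _ _).trans (le_of_eq ?_)
  congr 1; ring

/-- Delivering one request to each of `1` and `-1` takes three units of time. If it does not take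
more, the request with the first destination has been loaded in the beginning. -/
theorem Schedule.Serves.both_sides {s : Schedule} {δ t₀ : ℝ} (hδ : 0 < δ) (hδ' : δ < 1)
    (hs : s.Serves c {⟨-δ, -1, δ⟩, ⟨δ / 2, 1, δ / 2⟩} 0 t₀) :
    t₀ + 3 ≤ s.finish ∧ (s.finish ≤ t₀ + 3 → ∃ g : ℝ, (g = 1 ∨ g = -1) ∧
      s.pos s.finish = -g ∧ ∃ r ∈ ({⟨-δ, -1, δ⟩, ⟨δ / 2, 1, δ / 2⟩} : Finset Request),
        r.dst = g ∧ s.load r ≤ t₀ + δ ∧ t₀ + δ < s.unload r) := by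
  obtain ⟨hm, -, hR, -⟩ := hs
  set r₁ : Request := ⟨δ / 2, 1, δ / 2⟩ with hr₁
  set r₂ : Request := ⟨-δ, -1, δ⟩ with hr₂
  obtain ⟨a1, -, (a3 : _ = δ / 2), a4, (a5 : _ = 1), a6⟩ := hR r₁ (by simp)
  obtain ⟨b1, -, (b3 : _ = -δ), b4, (b5 : _ = -1), b6⟩ := hR r₂ (by simp)
  have a7 := abs_le.1 (hm.abs_sub_le (a1.trans a4))
  have b7 := abs_le.1 (hm.abs_sub_le (b1.trans b4))
  have a8 := abs_le.1 (hm.abs_sub_le_of_le a1 a4)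
  have b8 := abs_le.1 (hm.abs_sub_le_of_le b1 b4)
  rw [a5] at a7
  rw [b5] at b7
  rw [a3, a5] at a8
  rw [b3, b5] at b8
  -- The first destination costs one unit and the crossing two. With no slack, the first delivery is
  -- at `t₀ + 1`, and subtracting the length of its ride bounds its loading time by `t₀ + δ`.
  rcases le_total (s.unload r₁) (s.unload r₂) with h | h
  · have h1 := abs_le.1 (hm.abs_sub_le_of_le (a1.trans a4) h)
    rw [a5, b5] at h1
    refine ⟨by linarith [h1.1, a7.2], fun h2 => ⟨1, Or.inl rfl, ?_, r₁, by simp, rfl, ?_, ?_⟩⟩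
    · rw [show s.finish = s.unload r₂ by linarith [h1.1, a7.2]]; exact b5
    · linarith [h1.1, a8.2]
    · linarith [h1.1, a7.2]
  · have h1 := abs_le.1 (hm.abs_sub_le_of_le (b1.trans b4) h)
    rw [a5, b5] at h1
    refine ⟨by linarith [h1.2, b7.1], fun h2 => ⟨-1, Or.inr rfl, ?_, r₂, by simp, rfl, ?_, ?_⟩⟩
    · rw [show s.finish = s.unload r₁ by linarith [h1.2, b7.1], neg_neg]; exact a5
    · linarith [h1.2, b8.1]
    · linarith [h1.2, b7.1]

theorem vee_serves_both_sides (hc : 1 ≤ c) {δ t₀ : ℝ} (hδ : 0 < δ) (hδ' : δ < 1) (ht₀ : 0 ≤ t₀) :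
    (vee 1 t₀ (t₀ + 3)).Serves c {⟨-δ, -1, δ⟩, ⟨δ / 2, 1, δ / 2⟩} 0 t₀ := by
  refine vee_serves hc (Or.inl rfl) (by linarith) ?_ ?_
  · simp only [Finset.mem_insert, Finset.mem_singleton]
    rintro r (rfl | rfl)
    · left; refine ⟨?_, ?_, ?_, ?_, ?_, ?_⟩ <;> (try dsimp only) <;> linarith
    · right; refine ⟨?_, ?_, ?_, ?_⟩ <;> dsimp only <;> linarith
  · simp only [Finset.mem_insert, Finset.mem_singleton]
    rintro r (rfl | rfl) r' (rfl | rfl) hne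
    · exact absurd rfl hne
    · left; norm_num [vee]; linarith
    · right; norm_num [vee]; linarith
    · exact absurd rfl hne

/-- Each ride is released just when a server leaving the origin at time `0` can reach its source, so
either side can be visited first. Going to `-g` first, the server reaches `g * (F - 2)` exactly at
its release time `F`. -/
theorem opt_both_sides_and_point_le (hc : 1 ≤ c) {δ g F : ℝ} (hδ : 0 < δ) (hδ' : δ < 1)
    (hg : g = 1 ∨ g = -1) (hF : 3 ≤ F) :
    opt c {⟨g * (F - 2), g * (F - 2), F⟩, ⟨-δ, -1, δ⟩, ⟨δ / 2, 1, δ / 2⟩} ≤ F := by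
  refine opt_le_finish (s := vee g 0 F) (vee_serves hc hg (by linarith) ?_ ?_)
  · simp only [Finset.mem_insert, Finset.mem_singleton]
    rcases hg with rfl | rfl
    · rintro r (rfl | rfl | rfl)
      · right; refine ⟨?_, ?_, ?_, ?_⟩ <;> dsimp only <;> linarith
      · left; refine ⟨?_, ?_, ?_, ?_, ?_, ?_⟩ <;> (try dsimp only) <;> linarith
      · right; refine ⟨?_, ?_, ?_, ?_⟩ <;> dsimp only <;> linarith
    · rintro r (rfl | rfl | rfl)
      · right; refine ⟨?_, ?_, ?_, ?_⟩ <;> dsimp only <;> linarith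
      · right; refine ⟨?_, ?_, ?_, ?_⟩ <;> dsimp only <;> linarith
      · left; refine ⟨?_, ?_, ?_, ?_, ?_, ?_⟩ <;> (try dsimp only) <;> linarith
  · simp only [Finset.mem_insert, Finset.mem_singleton]
    have h1 : ¬ F - 2 < 0 := by linarith
    have h2 : ¬ F < 2 := by linarith
    rcases hg with rfl | rfl <;> rintro r (rfl | rfl | rfl) r' (rfl | rfl | rfl) hne <;>
      first
      | exact absurd rfl hne
      | (left; norm_num [vee, h1, h2]; done)
      | (right; norm_num [vee, h1, h2]; done)
      | (left; norm_num [vee, h1, h2]; linarith)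
      | (right; norm_num [vee, h1, h2]; linarith)

theorem ratio_ge_of_one_le (hc : 1 ≤ c) (hα : 1 ≤ α) {δ : ℝ} (hδ : 0 < δ) (hδ' : δ < 1)
    (hαδ : α * (3 * α + δ) < 3 * α + 2) :
    ENNReal.ofReal ((6 * α + 2 + δ) / (3 * α + δ)) ≤ lazyCompetitiveRatio tb α := by
  set r₁ : Request := ⟨δ / 2, 1, δ / 2⟩ with hr₁
  set r₂ : Request := ⟨-δ, -1, δ⟩ with hr₂
  have hR : ([r₂, r₁].toFinset : Finset Request) = {r₂, r₁} := by simp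
  have hfeas₁ : SweepFeasible ([r₁].toFinset) 0 1 := by
    constructor <;> simp [hr₁]; constructor <;> linarith
  have hopt₁ : opt c [r₁].toFinset = 1 :=
    hfeas₁.opt_eq hc zero_le_one (r := r₁) (by simp) rfl
  have hopt₂ : opt c [r₂, r₁].toFinset = 3 := by
    have h := vee_serves_both_sides hc hδ hδ' le_rfl
    rw [hR]
    refine le_antisymm ((opt_le_finish h).trans (by norm_num [vee])) (le_opt h fun s' hs' => ?_)
    linarith [(hs'.both_sides hδ hδ').1]
  have hS₀ := vee_serves_both_sides hc hδ hδ' (t₀ := α * 3) (by linarith)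
  have hS := tb.follow_spec [r₂, r₁] {r₂, r₁} 0 (α * 3)
    ⟨_, hS₀, fun s' hs' => (hs'.both_sides hδ hδ').1⟩
  obtain ⟨S, hS_eq⟩ : ∃ S, S = tb.follow [r₂, r₁] {r₂, r₁} 0 (α * 3) := ⟨_, rfl⟩
  rw [← hS_eq] at hS
  have hfin : S.finish ≤ α * 3 + 3 := hS.2 _ hS₀
  obtain ⟨hfin', hS'⟩ := hS.1.both_sides hδ hδ'
  obtain ⟨g, hg, hend, r, hr, hrdst, hload, hunload⟩ := hS' hfin
  have hgabs : |g| = 1 := by rcases hg with rfl | rfl <;> norm_num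
  -- The adversary reads `g` off the schedule that the deterministic rule selects and puts the last
  -- request on the side visited first.
  set r₃ : Request := ⟨g * (3 * α + δ - 2), g * (3 * α + δ - 2), 3 * α + δ⟩ with hr₃
  have hopt₃ : opt c {r₃, r₂, r₁} ≤ 3 * α + δ :=
    opt_both_sides_and_point_le hc hδ hδ' hg (by linarith)
  have hαopt : α * opt c [r₃, r₂, r₁].toFinset < 3 * α + 2 := by
    have : ([r₃, r₂, r₁].toFinset : Finset Request) = {r₃, r₂, r₁} := by simp
    rw [this]
    exact (mul_le_mul_of_nonneg_left hopt₃ (by linarith)).trans_lt hαδ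
  have hL : Late tb α (6 * α + 2 + δ) (Config.init [r₁, r₂, r₃]) := by
    refine late_of_release_at_origin (Or.inl rfl) ?_ ?_ ?_
    · simp only [List.mem_cons, List.not_mem_nil, or_false]
      rintro r (rfl | rfl) <;> simp only [hr₁, hr₂, hr₃] <;> linarith
    · rw [hopt₁]; simp only [hr₁]; linarith
    refine late_of_release_at_origin (Or.inr ⟨_, rfl, ?_⟩) ?_ ?_ ?_
    · rw [hopt₁]; simp only [hr₂]; linarith
    · simp only [List.mem_singleton]
      rintro r rfl
      simp only [hr₂, hr₃]; linarith
    · rw [hopt₂]; simp only [hr₂]; linarith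
    refine late_of_wait_over (by simp) ?_ ?_
    · rw [hopt₂]
      simp only [List.mem_singleton]
      rintro r rfl
      simp only [hr₃]; linarith
    rw [hopt₂, insert_empty_eq, ← hS_eq]
    refine late_of_release_during_schedule (by simp only [hr₃]; linarith)
      (fun S' hS' => hαopt.trans_le ?_) ?_
    · have hmem : r ∈ ({r₂, r₁} : Finset Request).filter
          (fun r => S.load r ≤ r₃.release ∧ r₃.release < S.unload r) := by
        refine Finset.mem_filter.2 ⟨hr, ?_, ?_⟩ <;> simp only [hr₃] <;> linarith
      -- The server is within `δ` of the origin and has to deliver in `g` before returning: `(3 * α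
      -- + δ) + (1 - δ) + 1 = 3 * α + 2`.
      have h1 := hS'.le_finish hmem
      have h2 := hS.1.1.abs_sub_le (t := r₃.release) (by simp only [hr₃]; linarith)
      have h3 : |g| - |S.pos r₃.release| ≤ |g - S.pos r₃.release| := abs_sub_abs_le_abs_sub _ _
      rw [hrdst] at h1
      rw [sub_zero] at h2
      linarith
    refine late_of_schedule_completed (P' := {r₃}) (by simp) hS.1 (by linarith) (by simp) ?_ ?_
    · have h₃ : r₃ ≠ r₁ ∧ r₃ ≠ r₂ := by
        constructor <;> intro h <;> have := congrArg Request.release h <;>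
          simp only [hr₁, hr₂, hr₃] at this <;> linarith
      ext r
      simp only [Finset.mem_sdiff, Finset.mem_insert, Finset.mem_filter, Finset.mem_singleton]
      constructor
      · tauto
      · rintro rfl; tauto
    rw [hend]
    refine late_of_last_point hc (by linarith) ?_
    rw [show g * (3 * α + δ - 2) - -g = g * (3 * α + δ - 1) by ring, abs_mul, hgabs,
      abs_of_nonneg (by linarith)]
    linarith
  refine ofReal_div_le_lazyCompetitiveRatio ⟨by simp, ?_, ?_⟩ hL (by linarith) ?_
  · simp only [List.mem_cons, List.not_mem_nil, or_false]
    rintro r (rfl | rfl | rfl) <;> simp only [hr₁, hr₂, hr₃] <;> linarith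
  · simp only [List.pairwise_cons, List.mem_cons, List.not_mem_nil, or_false, List.Pairwise.nil,
      forall_eq_or_imp, forall_eq, hr₁, hr₂, hr₃]
    refine ⟨⟨?_, ?_⟩, ?_, ?_, trivial⟩ <;> first | linarith | simp
  · have : ([r₁, r₂, r₃].toFinset : Finset Request) = {r₃, r₂, r₁} := by
      ext r; simp only [List.mem_toFinset, List.mem_cons, List.not_mem_nil, or_false,
        Finset.mem_insert, Finset.mem_singleton]; tauto
    rw [this]
    exact hopt₃

theorem ofReal_le_ratio_of_one_le (hc : 1 ≤ c) (hα : 1 ≤ α) :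
    ENNReal.ofReal (max (1 + α) (2 + 2 / (3 * α))) ≤ lazyCompetitiveRatio tb α := by
  -- The far point prevents the return for small `δ` exactly under the strict inequality; otherwise
  -- `1 + α` is already the larger term.
  rcases lt_or_ge (3 * α ^ 2) (3 * α + 2) with h | h
  · rw [ENNReal.ofReal_max]
    refine max_le (ofReal_one_add_le_ratio hc hα) ?_
    have hb : 0 < min 1 ((3 * α + 2 - 3 * α ^ 2) / α) :=
      lt_min one_pos (div_pos (by linarith) (by linarith))
    have h := ofReal_le_of_eventually_nhdsGT (A := lazyCompetitiveRatio tb α)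
      (f := fun δ => (6 * α + 2 + δ) / (3 * α + δ))
      (ContinuousAt.div (by fun_prop) (by fun_prop) (by linarith)) (by
        filter_upwards [Ioo_mem_nhdsGT hb] with δ hδ
        obtain ⟨h1, h2⟩ := hδ
        obtain ⟨h3, h4⟩ := lt_min_iff.1 h2
        rw [lt_div_iff₀ (by linarith)] at h4
        exact ratio_ge_of_one_le hc hα h1 h3 (by linarith))
    have hα0 : α ≠ 0 := by linarith
    have h2 : 2 + 2 / (3 * α) = (6 * α + 2 + 0) / (3 * α + 0) := by
      field_simp
      ring
    rwa [h2]
  · rw [max_eq_left]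
    · exact ofReal_one_add_le_ratio hc hα
    · have : 2 / (3 * α) ≤ α - 1 := by
        rw [div_le_iff₀ (by linarith)]; linarith
      linarith

/-! ### ### The bound that is uniform in `α` -/

/-- The increasing and the decreasing term meet at `α = 1 / 2 + √(11 / 12)`, the positive root of `3
* α ^ 2 = 3 * α + 2`. -/
theorem three_halves_add_sqrt_le_max (hα : 1 ≤ α) :
    3 / 2 + √(11 / 12) ≤ max (1 + α) (2 + 2 / (3 * α)) := by
  have hs : √(11 / 12 : ℝ) ^ 2 = 11 / 12 := Real.sq_sqrt (by norm_num)
  have h0 : 0 ≤ √(11 / 12 : ℝ) := Real.sqrt_nonneg _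
  rcases le_total (1 / 2 + √(11 / 12)) α with h | h
  · exact le_max_of_le_left (by linarith)
  · refine le_max_of_le_right ?_
    have : √(11 / 12) - 1 / 2 ≤ 2 / (3 * α) := by
      rw [le_div_iff₀ (by linarith)]
      have h1 : 1 / 2 ≤ √(11 / 12 : ℝ) := Real.le_sqrt_of_sq_le (by norm_num)
      -- This uses `(√(11 / 12) - 1 / 2) * (√(11 / 12) + 1 / 2) = 2 / 3`.
      nlinarith
    linarith

/-- The value `5 / 2` separates the two sides. -/
theorem three_halves_add_sqrt_le_of_lt_one (hα : 0 ≤ α) (hα1 : α < 1) :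
    3 / 2 + √(11 / 12) ≤ 1 + 3 / (α + 1) := by
  have h1 : √(11 / 12 : ℝ) ≤ 1 := Real.sqrt_le_one.2 (by norm_num)
  have h2 : 3 / 2 ≤ 3 / (α + 1) := by
    rw [le_div_iff₀ (by linarith)]; linarith
  linarith

end

end DialARide

theorem corollary1 (c : ℕ∞) (hc : 1 ≤ c) (α : ℝ) (hα : 0 ≤ α) (tb : DialARide.TieBreaking c) :
    ENNReal.ofReal (3 / 2 + √(11 / 12)) ≤ DialARide.lazyCompetitiveRatio tb α ∧
    (1 ≤ α →
      ENNReal.ofReal (max (1 + α) (2 + 2 / (3 * α))) ≤ DialARide.lazyCompetitiveRatio tb α) ∧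
    (α < 1 →
      ENNReal.ofReal (1 + 3 / (α + 1)) ≤ DialARide.lazyCompetitiveRatio tb α) := by
  refine ⟨?_, DialARide.ofReal_le_ratio_of_one_le hc, DialARide.ofReal_le_ratio_of_lt_one hc hα⟩
  rcases le_or_gt 1 α with h | h
  · exact (ENNReal.ofReal_le_ofReal (DialARide.three_halves_add_sqrt_le_max h)).trans
      (DialARide.ofReal_le_ratio_of_one_le hc h)
  · exact (ENNReal.ofReal_le_ofReal (DialARide.three_halves_add_sqrt_le_of_lt_one hα h)).trans
      (DialARide.ofReal_le_ratio_of_lt_one hc hα h)
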